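/- Let $q\ge 1$ be an integer. There is a constant $C_q$, depending on $q$ only, with the following property. Let $\varphi_1,\dots,\varphi_N$ be real numbers that are linearly independent over $\mathbb{Q}$, let $c_1,\dots,c_N$ be complex numbers, let $J\subset\mathbb{R}$ be a bounded interval of length $|J|>0$, and let $m_J$ be the normalized Lebesgue measure on $J$. For real $\theta,t$ put $P_\theta(t)=\sum_{n=1}^N c_n e^{i(\theta+t)\varphi_n}$, and let $\tilde\varphi_N=\max_{n\le N}|\varphi_n|$. Let $E_q$ be the set of $N$-tuples $k=(k_1,\dots,k_N)$ of nonnegative integers with $k_1+\dots+k_N=q$, and put $$\xi=\inf_{h,k\in E_q,\ h\ne k}\Big|\sum_{n=1}^N (h_n-k_n)\varphi_n\Big|$$ (with $\xi=\infty$ if there are no such $h,k$) and $$\mathcal{B}=\Big[q!\Big(1+\frac{2\pi}{|J|\,\xi}\Big)\Big]^{1/2q}.$$ Then for every interval $L\subset\mathbb{R}$, with length $|L|$, $$\Big\|\sup_{t\in L}|P_\theta(t)|\Big\|_{L^{2q}(m_J(d\theta))}\le C_q\,\mathcal{B}\,\max\{1,|L|\tilde\varphi_N\}^{1/2q}\Big\{\Big(\sum_{n=1}^N|c_n|^2\Big)^{1/2}+\min\Big(|L|,\frac1{\tilde\varphi_N}\Big)\Big(\sum_{n=1}^N|c_n|^2\varphi_n^2\Big)^{1/2}\Big\}.$$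 -/

import Mathlib

open MeasureTheory ProbabilityTheory
open scoped ENNReal NNReal

namespace LocalMeanValue

/-- The shifted Dirichlet polynomial `P_θ(t) = ∑ n, c n * exp (i (θ + t) φ n)`. -/
noncomputable def shiftedPoly {N : ℕ} (c : Fin N → ℂ) (φ : Fin N → ℝ) (θ t : ℝ) : ℂ :=
  ∑ n, c n * Complex.exp (Complex.I * ((θ + t) * φ n : ℝ))

/-- The set `E_q` of vectors of nonnegative integers `(k_1, …, k_N)` with sum `q`. -/
def indexSet (N q : ℕ) : Set (Fin N → ℕ) := {k | ∑ n, k n = q}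

/-- The coefficient of linear spacing `ξ_φ(N, q)`: the infimum of
`|∑ n, (h n - k n) * φ n|` over distinct `h, k ∈ E_q`. It lives in `[0, ∞]`, so that it is `∞`
when `E_q` does not have two distinct elements. -/
noncomputable def linearSpacing {N : ℕ} (φ : Fin N → ℝ) (q : ℕ) : ℝ≥0∞ :=
  ⨅ (h ∈ indexSet N q) (k ∈ indexSet N q) (_ : h ≠ k),
    ENNReal.ofReal |∑ n, ((h n : ℝ) - (k n : ℝ)) * φ n|

/-- `𝓑_φ(J, N, q) = [q! (1 + 2π / (|J| ξ_φ(N, q)))]^(1 / 2q)`. -/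
noncomputable def factorB {N : ℕ} (φ : Fin N → ℝ) (J : Set ℝ) (q : ℕ) : ℝ≥0∞ :=
  ((q.factorial : ℝ≥0∞) *
    (1 + ENNReal.ofReal (2 * Real.pi) / (volume J * linearSpacing φ q))) ^ (1 / (2 * (q : ℝ)))

/-- The largest modulus `max_n |φ_n|` of the frequencies. -/
noncomputable def maxFreq {N : ℕ} (φ : Fin N → ℝ) : ℝ≥0∞ := ⨆ n, ENNReal.ofReal |φ n|

end LocalMeanValue

/-!
A power of a Dirichlet polynomial is again an exponential sum: by the multinomial theorem `P_θ(t)^q`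
has frequencies `∑ k n * φ n` for `k ∈ E_q`, which are `ξ`-separated by definition of `ξ`, and the
squares of its coefficients add up to at most `q! (∑ |c n|²)^q`. So `∫_J |P_θ(t)|^{2q} dθ` is an
`L²` norm of an exponential sum with separated frequencies over an interval, and the mean value
inequality of large sieve type (`setIntegral_norm_exp_sum_sq_le`) bounds it by a constant times
`(|J| + 1/ξ) q! (∑ |c n|²)^q`. That inequality follows from Plancherel: the sum, multiplied by the
Fourier transform of a smooth bump of width comparable to the separation, is the Fourier transform of
a sum of disjointly supported translates of the bump, while the transform of the bump is bounded
below on the interval. Since frequencies that are `ξ`-separated are also `min(ξ, 1/|J|)`-separated,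
the interval may be assumed to be short compared with the inverse of the separation, and no covering
of `J` is needed. The result is `lintegral_enorm_shiftedPoly_pow_le`.

The supremum over `t ∈ L` is controlled by a one-dimensional Sobolev inequality at scale
`ℓ = min(|L|, 1/max |φ n|)` (`mul_enorm_pow_le_lintegral`):
`ℓ |f(t)|^p ≤ 4^p (∫_L |f|^p + ℓ^p ∫_L |f'|^p)` for every `t ∈ L`. The derivative of `P_θ` is a
polynomial of the same kind with coefficients `i c n φ n`, so integrating in `θ`, exchanging the
integrals and applying the mean value estimate for each fixed `t` gives the factor
`|L| / ℓ = max(1, |L| max |φ n|)` and the two sums on the right-hand side. If `|L| = 0` then `L` has at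
most one point, and the mean value estimate alone suffices. The constant comes out independent of `q`.
-/

namespace LocalMeanValue

/-! ### Mean squares of exponential sums with separated frequencies -/

section ExponentialSums

open scoped FourierTransform ContDiff SchwartzMap

/-- The Fourier transform of a bump function supported in a ball of radius `rOut` stays away from zero
at frequencies small compared with `1 / rOut`, because the phase is nearly constant on the support. -/
theorem rIn_le_norm_integral_exp_mul_bump (ψ : ContDiffBump (0 : ℝ)) {u : ℝ}
    (hu : ψ.rOut * (2 * Real.pi * |u|) ≤ 1 / 4) :
    ψ.rIn ≤ ‖∫ v : ℝ, Complex.exp ((-2 * Real.pi * v * u : ℝ) * Complex.I) * (ψ v : ℂ)‖ := by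
  have hint : Integrable (fun v : ℝ => ψ v) := ψ.integrable
  have hintC : Integrable (fun v : ℝ => (ψ v : ℂ)) := hint.ofReal
  have hexp : Integrable
      (fun v : ℝ => Complex.exp ((-2 * Real.pi * v * u : ℝ) * Complex.I) * (ψ v : ℂ)) := by
    refine hintC.mono (Continuous.aestronglyMeasurable ?_) (Filter.Eventually.of_forall ?_)
    · have := ψ.continuous; fun_prop
    · intro v; simp only [norm_mul, Complex.norm_exp_ofReal_mul_I, one_mul, le_refl]
  have hdiff : ‖(∫ v : ℝ, Complex.exp ((-2 * Real.pi * v * u : ℝ) * Complex.I) * (ψ v : ℂ))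
      - ∫ v : ℝ, (ψ v : ℂ)‖ ≤ 1 / 4 * ∫ v : ℝ, ψ v := by
    rw [← integral_sub hexp hintC, ← integral_const_mul]
    refine norm_integral_le_of_norm_le (hint.const_mul _) (Filter.Eventually.of_forall ?_)
    intro v
    by_cases hv : |v| < ψ.rOut
    · rw [show Complex.exp ((-2 * Real.pi * v * u : ℝ) * Complex.I) * (ψ v : ℂ) - ψ v
        = (Complex.exp (Complex.I * (-2 * Real.pi * v * u : ℝ)) - 1) * (ψ v : ℂ) by
          rw [mul_comm Complex.I]; ring, norm_mul, Complex.norm_real, Real.norm_eq_abs,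
          abs_of_nonneg ψ.nonneg]
      refine mul_le_mul_of_nonneg_right ?_ ψ.nonneg
      refine Real.norm_exp_I_mul_ofReal_sub_one_le.trans ?_
      have : ‖(-2 * Real.pi * v * u : ℝ)‖ = |v| * (2 * Real.pi * |u|) := by
        simp only [Real.norm_eq_abs, abs_mul, abs_neg, abs_two, abs_of_pos Real.pi_pos]; ring
      rw [this]
      refine le_trans (mul_le_mul_of_nonneg_right hv.le ?_) hu
      have := Real.pi_pos; positivity
    · have : ψ v = 0 := ψ.zero_of_le_dist (by simpa using hv)
      simp [this]
  have hlow : 2 * ψ.rIn ≤ ∫ v : ℝ, ψ v := by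
    have := ψ.measure_closedBall_le_integral volume
    simpa [Measure.real, Real.volume_closedBall, ψ.rIn_pos.le] using this
  have h3 : ‖∫ v : ℝ, (ψ v : ℂ)‖ = ∫ v : ℝ, ψ v := by
    rw [integral_complex_ofReal, Complex.norm_real, Real.norm_eq_abs, abs_of_nonneg]
    exact integral_nonneg fun v => ψ.nonneg
  have h4 := norm_sub_norm_le (∫ v : ℝ, (ψ v : ℂ))
    (∫ v : ℝ, Complex.exp ((-2 * Real.pi * v * u : ℝ) * Complex.I) * (ψ v : ℂ))
  rw [norm_sub_rev] at h4
  have := ψ.rIn_pos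
  linarith

/-- Translates of a function supported in `(-r, r)` to `2 * r`-separated points have disjoint supports,
so that the square of their sum has no cross terms. -/
theorem norm_sum_translates_sq_le {ι : Type*} (s : Finset ι) (μ : ι → ℝ) (a : ι → ℂ) {r : ℝ}
    (hμ : ∀ i ∈ s, ∀ j ∈ s, i ≠ j → 2 * r ≤ |μ i - μ j|)
    (g : ℝ → ℂ) (hg : ∀ v, ‖g v‖ ≤ 1) (hg0 : ∀ v, r ≤ |v| → g v = 0) (v : ℝ) :
    ‖∑ j ∈ s, a j * g (v - μ j)‖ ^ 2
      ≤ ∑ j ∈ s, (Metric.closedBall (μ j) r).indicator (fun _ => ‖a j‖ ^ 2) v := by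
  have hnn : ∀ j ∈ s, 0 ≤ (Metric.closedBall (μ j) r).indicator (fun _ => ‖a j‖ ^ 2) v :=
    fun j _ => Set.indicator_nonneg (fun _ _ => by positivity) _
  by_cases h : ∃ j ∈ s, |v - μ j| < r
  · obtain ⟨j, hj, hvj⟩ := h
    rw [Finset.sum_eq_single_of_mem j hj]
    · refine le_trans ?_ (Finset.single_le_sum hnn hj)
      rw [Set.indicator_of_mem (by rw [Metric.mem_closedBall, Real.dist_eq]; exact hvj.le), norm_mul]
      have := hg (v - μ j)
      gcongr
      exact mul_le_of_le_one_right (norm_nonneg _) this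
    · intro i hi hij
      rw [hg0, mul_zero]
      by_contra hlt
      have h1 := hμ i hi j hj hij
      have h2 : |μ i - μ j| ≤ |v - μ i| + |v - μ j| := by
        rw [show μ i - μ j = (v - μ j) - (v - μ i) by ring, add_comm]; exact abs_sub _ _
      linarith
  · push Not at h
    rw [Finset.sum_eq_zero fun j hj => by rw [hg0 _ (h j hj), mul_zero]]
    simpa using Finset.sum_nonneg hnn

/-- A mean value inequality of large sieve type: exponential sums with `δ`-separated frequencies are
almost orthogonal on every interval of length at most `1 / (π δ)`. -/
theorem setIntegral_norm_exp_sum_sq_le {ι : Type*} (s : Finset ι) (μ : ι → ℝ) (a : ι → ℂ)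
    {δ T : ℝ} (x₀ : ℝ) (hδ : 0 < δ) (hT : 2 * Real.pi * T * δ ≤ 1)
    (hμ : ∀ i ∈ s, ∀ j ∈ s, i ≠ j → δ ≤ |μ i - μ j|) :
    ∫ x in Set.Icc (x₀ - T) (x₀ + T),
        ‖∑ j ∈ s, a j * Complex.exp ((-2 * Real.pi * μ j * x : ℝ) * Complex.I)‖ ^ 2
      ≤ 32 / δ * ∑ j ∈ s, ‖a j‖ ^ 2 := by
  -- The radius `δ / 4` keeps the translates disjoint; the modulation by `x₀` moves the region where the
  -- transform of the bump is large to a neighbourhood of `x₀`.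
  let ψ : ContDiffBump (0 : ℝ) := ⟨δ / 8, δ / 4, by positivity, by linarith⟩
  set g : ℝ → ℂ := fun v => Complex.exp ((2 * Real.pi * x₀ * v : ℝ) * Complex.I) * (ψ v : ℂ) with hg
  have hgs : ContDiff ℝ ∞ g := by
    have h1 : ContDiff ℝ ∞ (fun v : ℝ => (ψ v : ℂ)) := Complex.ofRealCLM.contDiff.comp ψ.contDiff
    have h2 : ContDiff ℝ ∞ (fun v : ℝ => Complex.exp ((2 * Real.pi * x₀ * v : ℝ) * Complex.I)) :=
      ((Complex.ofRealCLM.contDiff.comp (contDiff_const.mul contDiff_id)).mul contDiff_const).cexp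
    exact h2.mul h1
  have hg1 : ∀ v, ‖g v‖ ≤ 1 := fun v => by
    rw [hg]
    simp only [norm_mul, Complex.norm_exp_ofReal_mul_I, one_mul, Complex.norm_real,
      Real.norm_eq_abs, abs_of_nonneg ψ.nonneg]
    exact ψ.le_one
  have hg0 : ∀ v, δ / 4 ≤ |v| → g v = 0 := fun v hv => by
    have : ψ v = 0 := ψ.zero_of_le_dist (by simpa using hv)
    simp [hg, this]
  have hgj : ∀ m : ℝ, HasCompactSupport (fun v => g (v - m)) := fun m => by
    refine HasCompactSupport.intro (isCompact_closedBall m (δ / 4)) fun v hv => hg0 _ ?_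
    rw [Metric.mem_closedBall, Real.dist_eq, not_le] at hv
    exact hv.le
  have hfs : ContDiff ℝ ∞ (fun v => ∑ j ∈ s, a j * g (v - μ j)) :=
    ContDiff.sum fun j _ => contDiff_const.mul (hgs.comp (contDiff_id.sub contDiff_const))
  have hfc : HasCompactSupport (fun v => ∑ j ∈ s, a j * g (v - μ j)) := by
    refine HasCompactSupport.intro
      (s.isCompact_biUnion fun j _ => isCompact_closedBall (μ j) (δ / 4)) fun v hv => ?_
    refine Finset.sum_eq_zero fun j hj => ?_
    rw [hg0, mul_zero]
    by_contra h
    refine hv (Set.mem_biUnion hj ?_)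
    rw [Metric.mem_closedBall, Real.dist_eq]
    linarith
  let f : 𝓢(ℝ, ℂ) := hfc.toSchwartzMap hfs
  have hf : ∀ v, f v = ∑ j ∈ s, a j * g (v - μ j) := fun v => rfl
  -- The transform of `f` is the exponential sum times the transform of the bump, centred at `x₀`.
  have hfour : ∀ x : ℝ, 𝓕 f x = (∫ v : ℝ, Complex.exp ((-2 * Real.pi * v * (x - x₀) : ℝ) * Complex.I)
      * (ψ v : ℂ)) * ∑ j ∈ s, a j * Complex.exp ((-2 * Real.pi * μ j * x : ℝ) * Complex.I) := by
    intro x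
    rw [SchwartzMap.fourier_coe, Real.fourier_real_eq_integral_exp_smul]
    simp_rw [hf, smul_eq_mul, Finset.mul_sum]
    rw [integral_finsetSum]
    · refine Finset.sum_congr rfl fun j _ => ?_
      rw [← integral_add_right_eq_self _ (μ j), ← integral_mul_const]
      refine integral_congr_ae (Filter.Eventually.of_forall fun v => ?_)
      simp only [hg, add_sub_cancel_right]
      rw [show ((-2 * Real.pi * (v + μ j) * x : ℝ) : ℂ) * Complex.I
        = ((-2 * Real.pi * v * (x - x₀) : ℝ) : ℂ) * Complex.I
          + (-((2 * Real.pi * x₀ * v : ℝ) * Complex.I)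
          + ((-2 * Real.pi * μ j * x : ℝ) : ℂ) * Complex.I) by push_cast; ring,
        Complex.exp_add, Complex.exp_add, Complex.exp_neg]
      field_simp [Complex.exp_ne_zero]
    · intro j _
      have h1 : Continuous (fun v => g (v - μ j)) := by have := hgs.continuous; fun_prop
      refine ((h1.integrable_of_hasCompactSupport (hgj (μ j))).const_mul (a j)).mono
        (Continuous.aestronglyMeasurable (by fun_prop)) (Filter.Eventually.of_forall fun v => ?_)
      simp only [norm_mul, Complex.norm_exp_ofReal_mul_I, one_mul, le_refl]
  have hfint : Integrable (fun x => ‖𝓕 f x‖ ^ 2) := by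
    simpa using ((𝓕 f).memLp 2 volume).integrable_norm_pow (by norm_num)
  have hfint' : Integrable (fun x => ‖f x‖ ^ 2) := by
    simpa using (f.memLp 2 volume).integrable_norm_pow (by norm_num)
  calc _ ≤ ∫ x in Set.Icc (x₀ - T) (x₀ + T), (64 / δ ^ 2) * ‖𝓕 f x‖ ^ 2 := by
        refine setIntegral_mono_on (Continuous.integrableOn_Icc (by fun_prop))
          (hfint.const_mul _).integrableOn measurableSet_Icc fun x hx => ?_
        have h1 := rIn_le_norm_integral_exp_mul_bump ψ (u := x - x₀) (by
          have h2 : |x - x₀| ≤ T := by rw [abs_le]; constructor <;> linarith [hx.1, hx.2]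
          have h3 := mul_le_mul_of_nonneg_left h2 (by positivity : 0 ≤ δ / 4 * (2 * Real.pi))
          change δ / 4 * (2 * Real.pi * |x - x₀|) ≤ 1 / 4
          linarith)
        change δ / 8 ≤ _ at h1
        rw [hfour, norm_mul, mul_pow, ← mul_assoc]
        refine le_mul_of_one_le_left (by positivity) ?_
        have h2 := pow_le_pow_left₀ (by positivity) h1 2
        rw [div_mul_eq_mul_div, one_le_div (by positivity)]
        linarith
    _ ≤ (64 / δ ^ 2) * ∫ x, ‖𝓕 f x‖ ^ 2 := by
        rw [integral_const_mul]
        refine mul_le_mul_of_nonneg_left ?_ (by positivity)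
        exact setIntegral_le_integral hfint (Filter.Eventually.of_forall fun x => by positivity)
    _ = (64 / δ ^ 2) * ∫ x, ‖f x‖ ^ 2 := by rw [SchwartzMap.integral_norm_sq_fourier]
    _ ≤ (64 / δ ^ 2) * ∑ j ∈ s, δ / 2 * ‖a j‖ ^ 2 := by
        refine mul_le_mul_of_nonneg_left ?_ (by positivity)
        have hI : ∀ j ∈ s, Integrable
            ((Metric.closedBall (μ j) (δ / 4)).indicator (fun _ : ℝ => ‖a j‖ ^ 2)) := fun j _ =>
          (integrable_indicator_iff Metric.isClosed_closedBall.measurableSet).2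
            (integrableOn_const (isCompact_closedBall _ _).measure_lt_top.ne)
        calc ∫ x, ‖f x‖ ^ 2 ≤ ∫ x, ∑ j ∈ s,
              (Metric.closedBall (μ j) (δ / 4)).indicator (fun _ => ‖a j‖ ^ 2) x := by
              refine integral_mono hfint' (integrable_finsetSum _ hI) fun x => ?_
              exact norm_sum_translates_sq_le s μ a
                (fun i hi j hj hij => by linarith [hμ i hi j hj hij]) g hg1 hg0 x
          _ ≤ _ := by
              rw [integral_finsetSum _ hI]
              refine Finset.sum_le_sum fun j _ => ?_
              rw [integral_indicator_const _ Metric.isClosed_closedBall.measurableSet, Measure.real,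
                Real.volume_closedBall, ENNReal.toReal_ofReal (by positivity), smul_eq_mul]
              exact (by ring : 2 * (δ / 4) * ‖a j‖ ^ 2 = δ / 2 * ‖a j‖ ^ 2).le
    _ = _ := by
        rw [← Finset.mul_sum]; field_simp; ring

end ExponentialSums

/-! ### Moments of the polynomial at a fixed point -/

theorem multinomial_le_factorial {ι : Type*} (s : Finset ι) (k : ι → ℕ) :
    Nat.multinomial s k ≤ (∑ i ∈ s, k i).factorial := by
  rw [← Nat.multinomial_spec s k]
  exact Nat.le_mul_of_pos_left _ (Finset.prod_pos fun i _ => Nat.factorial_pos _)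

/-- The coefficients of `(∑ x n)^q`, squared and summed: each multinomial coefficient is at most `q!`,
so one of its two factors can be replaced by `q!` and the multinomial theorem applied to `x n ^ 2`. -/
theorem sum_multinomial_mul_prod_sq_le {N : ℕ} (x : Fin N → ℝ) (q : ℕ) :
    ∑ k ∈ Finset.piAntidiag Finset.univ q,
        ((Nat.multinomial Finset.univ k : ℝ) * ∏ n, x n ^ k n) ^ 2
      ≤ q.factorial * (∑ n, x n ^ 2) ^ q := by
  rw [Finset.sum_pow_eq_sum_piAntidiag, Finset.mul_sum]
  refine Finset.sum_le_sum fun k hk => ?_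
  have hk' : (Nat.multinomial Finset.univ k : ℝ) ≤ q.factorial := by
    have := multinomial_le_factorial Finset.univ k
    rw [(Finset.mem_piAntidiag.1 hk).1] at this
    exact_mod_cast this
  rw [mul_pow, sq (Nat.multinomial Finset.univ k : ℝ), ← Finset.prod_pow, mul_assoc]
  simp_rw [← pow_mul, mul_comm 2]
  refine mul_le_mul_of_nonneg_right hk' (mul_nonneg (Nat.cast_nonneg _) ?_)
  exact Finset.prod_nonneg fun n _ => by rw [mul_comm, pow_mul]; positivity

/-- The `q`-th power of `P_θ(t)` as an exponential sum in `θ`, with frequencies indexed by `E_q` and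
normalized as `exp (-2π i μ θ)`, the convention of the Fourier transform. -/
theorem shiftedPoly_pow {N : ℕ} (c : Fin N → ℂ) (φ : Fin N → ℝ) (θ t : ℝ) (q : ℕ) :
    shiftedPoly c φ θ t ^ q = ∑ k ∈ Finset.piAntidiag Finset.univ q,
      ((Nat.multinomial Finset.univ k : ℂ) * (∏ n, c n ^ k n)
        * Complex.exp ((t * ∑ n, (k n : ℝ) * φ n : ℝ) * Complex.I))
      * Complex.exp ((-2 * Real.pi * (-(∑ n, (k n : ℝ) * φ n) / (2 * Real.pi)) * θ : ℝ)
          * Complex.I) := by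
  rw [shiftedPoly, Finset.sum_pow_eq_sum_piAntidiag]
  refine Finset.sum_congr rfl fun k _ => ?_
  rw [mul_assoc _ (Complex.exp _), ← Complex.exp_add, mul_assoc]
  congr 1
  simp_rw [mul_pow, Finset.prod_mul_distrib]
  congr 1
  simp_rw [← Complex.exp_nat_mul]
  rw [← Complex.exp_sum]
  congr 1
  have h : -2 * Real.pi * (-(∑ n, (k n : ℝ) * φ n) / (2 * Real.pi)) * θ
      = θ * ∑ n, (k n : ℝ) * φ n := by
    field_simp
  rw [h, ← add_mul, ← Complex.ofReal_add, ← add_mul, Finset.mul_sum, Complex.ofReal_sum,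
    Finset.sum_mul]
  refine Finset.sum_congr rfl fun n _ => ?_
  push_cast; ring

theorem setIntegral_norm_shiftedPoly_pow_le {N : ℕ} (c : Fin N → ℂ) (φ : Fin N → ℝ) (q : ℕ)
    (t x₀ : ℝ) {δ T : ℝ} (hδ : 0 < δ) (hT : T * δ ≤ 1)
    (hφ : ∀ h ∈ Finset.piAntidiag Finset.univ q, ∀ k ∈ Finset.piAntidiag Finset.univ q, h ≠ k →
      δ ≤ |∑ n : Fin N, ((h n : ℝ) - (k n : ℝ)) * φ n|) :
    ∫ θ in Set.Icc (x₀ - T) (x₀ + T), ‖shiftedPoly c φ θ t‖ ^ (2 * q)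
      ≤ 256 / δ * (q.factorial * (∑ n, ‖c n‖ ^ 2) ^ q) := by
  have hπ := Real.pi_pos
  have h := setIntegral_norm_exp_sum_sq_le (Finset.piAntidiag Finset.univ q)
    (fun k : Fin N → ℕ => -(∑ n, (k n : ℝ) * φ n) / (2 * Real.pi))
    (fun k => (Nat.multinomial Finset.univ k : ℂ) * (∏ n, c n ^ k n)
        * Complex.exp ((t * ∑ n, (k n : ℝ) * φ n : ℝ) * Complex.I))
    (δ := δ / (2 * Real.pi)) (T := T) x₀ (by positivity)
    (by rw [mul_right_comm, mul_div_cancel₀ _ (by positivity), mul_comm]; exact hT) (by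
      intro i hi j hj hij
      have h1 := hφ i hi j hj hij
      have h2 : -(∑ n, (i n : ℝ) * φ n) / (2 * Real.pi) - -(∑ n, (j n : ℝ) * φ n) / (2 * Real.pi)
          = -(∑ n, ((i n : ℝ) - (j n : ℝ)) * φ n) / (2 * Real.pi) := by
        simp_rw [sub_mul, Finset.sum_sub_distrib]; ring
      rw [h2, abs_div, abs_neg, abs_of_pos (by positivity : 0 < 2 * Real.pi)]
      gcongr)
  simp_rw [← shiftedPoly_pow, norm_mul, Complex.norm_exp_ofReal_mul_I, mul_one, norm_prod, norm_pow,
    Complex.norm_natCast, ← pow_mul, mul_comm q 2] at h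
  refine h.trans (mul_le_mul ?_ (sum_multinomial_mul_prod_sq_le _ q) (by positivity) (by positivity))
  rw [div_div_eq_mul_div]
  gcongr
  -- `32 * (2 * π) ≤ 256`
  linarith [Real.pi_lt_four]

theorem continuous_shiftedPoly {N : ℕ} (c : Fin N → ℂ) (φ : Fin N → ℝ) :
    Continuous fun x : ℝ × ℝ => shiftedPoly c φ x.1 x.2 := by
  unfold shiftedPoly
  fun_prop

/-- The infimum is over finitely many pairs, each of which contributes a positive number by linear
independence. -/
theorem linearSpacing_ne_zero {N : ℕ} {φ : Fin N → ℝ} (hφ : LinearIndependent ℚ φ) (q : ℕ) :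
    linearSpacing φ q ≠ 0 := by
  classical
  have hpos : 0 < (Finset.piAntidiag Finset.univ q).offDiag.inf fun p : (Fin N → ℕ) × (Fin N → ℕ) =>
      ENNReal.ofReal |∑ n, ((p.1 n : ℝ) - (p.2 n : ℝ)) * φ n| := by
    rw [Finset.lt_inf_iff ENNReal.zero_lt_top]
    intro p hp
    rw [ENNReal.ofReal_pos, abs_pos]
    intro h0
    refine (Finset.mem_offDiag.1 hp).2.2 (funext fun n => ?_)
    have := Fintype.linearIndependent_iff.1 hφ (fun n => (p.1 n : ℚ) - (p.2 n : ℚ)) (by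
      rw [← h0]
      refine Finset.sum_congr rfl fun n _ => ?_
      rw [Rat.smul_def]; push_cast; ring) n
    exact_mod_cast sub_eq_zero.1 this
  refine (hpos.trans_le ?_).ne'
  refine le_iInf₂ fun h hh => le_iInf₂ fun k hk => le_iInf fun hne => ?_
  exact Finset.inf_le (f := fun p : (Fin N → ℕ) × (Fin N → ℕ) =>
      ENNReal.ofReal |∑ n, ((p.1 n : ℝ) - (p.2 n : ℝ)) * φ n|) (b := (h, k))
    (Finset.mem_offDiag.2 ⟨Finset.mem_piAntidiag.2 ⟨hh, by simp⟩,
      Finset.mem_piAntidiag.2 ⟨hk, by simp⟩, hne⟩)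

theorem subset_Icc_of_volume_le {J : Set ℝ} (hJ : J.OrdConnected) {x₀ T : ℝ} (hx : x₀ ∈ J)
    (hT : volume J ≤ ENNReal.ofReal T) (hT0 : 0 ≤ T) : J ⊆ Set.Icc (x₀ - T) (x₀ + T) := by
  intro y hy
  have h := (measure_mono (hJ.uIcc_subset hx hy)).trans hT
  rw [Real.volume_interval, ENNReal.ofReal_le_ofReal_iff hT0, abs_le] at h
  constructor <;> linarith [h.1, h.2]

/-- The mean value estimate on a short interval, for any `d ≤ ξ` with `T * d ≤ 1`. -/
theorem setLIntegral_enorm_shiftedPoly_pow_le {N : ℕ} (c : Fin N → ℂ) (φ : Fin N → ℝ) (q : ℕ)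
    (t x₀ : ℝ) {d : ℝ≥0∞} {T : ℝ} (hd0 : d ≠ 0) (hdt : d ≠ ∞) (hT : T * d.toReal ≤ 1)
    (hd : d ≤ linearSpacing φ q) :
    ∫⁻ θ in Set.Icc (x₀ - T) (x₀ + T), ‖shiftedPoly c φ θ t‖ₑ ^ (2 * q)
      ≤ 256 / d * (q.factorial * (∑ n, ‖c n‖ₑ ^ 2) ^ q) := by
  have hδ : 0 < d.toReal := ENNReal.toReal_pos hd0 hdt
  have hreal := setIntegral_norm_shiftedPoly_pow_le c φ q t x₀ hδ hT (by
    intro h hh k hk hne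
    rw [← ENNReal.ofReal_le_ofReal_iff (abs_nonneg _), ENNReal.ofReal_toReal hdt]
    refine hd.trans ?_
    exact iInf₂_le_of_le h (Finset.mem_piAntidiag.1 hh).1
      (iInf₂_le_of_le k (Finset.mem_piAntidiag.1 hk).1 (iInf_le _ hne)))
  have hcont : Continuous fun θ => shiftedPoly c φ θ t := by
    simp only [shiftedPoly]
    fun_prop
  calc ∫⁻ θ in Set.Icc (x₀ - T) (x₀ + T), ‖shiftedPoly c φ θ t‖ₑ ^ (2 * q)
      = ENNReal.ofReal (∫ θ in Set.Icc (x₀ - T) (x₀ + T), ‖shiftedPoly c φ θ t‖ ^ (2 * q)) := by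
        rw [ofReal_integral_eq_lintegral_ofReal
          (Continuous.integrableOn_Icc (by fun_prop))
          (Filter.Eventually.of_forall fun θ => by positivity)]
        refine lintegral_congr fun θ => ?_
        rw [ENNReal.ofReal_pow (norm_nonneg _), ofReal_norm]
    _ ≤ _ := ENNReal.ofReal_le_ofReal hreal
    _ = _ := by
        rw [ENNReal.ofReal_mul (by positivity), ENNReal.ofReal_mul (by positivity),
          ENNReal.ofReal_div_of_pos hδ, ENNReal.ofReal_toReal hdt, ENNReal.ofReal_natCast,
          ENNReal.ofReal_pow (by positivity), ENNReal.ofReal_sum_of_nonneg (fun _ _ => by positivity),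
          ENNReal.ofReal_ofNat]
        simp_rw [ENNReal.ofReal_pow (norm_nonneg _), ofReal_norm]

/-- The bound `256 / d` of the mean value estimate with `d = min ξ (1 / V)`, averaged over an interval
of length `V`, is controlled by `1 + 2π / (V ξ)`. The case `ξ = ∞` is included. -/
theorem inv_mul_div_min_le {V ξ : ℝ≥0∞} (hV0 : V ≠ 0) (hVt : V ≠ ∞) :
    V⁻¹ * (256 / min ξ V⁻¹) ≤ 256 * (1 + ENNReal.ofReal (2 * Real.pi) / (V * ξ)) := by
  rw [div_eq_mul_inv, mul_left_comm]
  gcongr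
  rcases min_choice ξ V⁻¹ with h | h
  · rw [h, ← ENNReal.mul_inv (Or.inl hV0) (Or.inl hVt), div_eq_mul_inv]
    refine le_add_left (le_mul_of_one_le_left zero_le ?_)
    rw [ENNReal.one_le_ofReal]
    linarith [Real.pi_gt_three]
  · rw [h, inv_inv, ENNReal.inv_mul_cancel hV0 hVt]
    exact le_self_add

/-- The mean value estimate for a fixed `t`, on an arbitrary bounded interval `J`. -/
theorem lintegral_enorm_shiftedPoly_pow_le {N : ℕ} (c : Fin N → ℂ) {φ : Fin N → ℝ}
    (hφ : LinearIndependent ℚ φ) (q : ℕ) {J : Set ℝ} (hJ : J.OrdConnected)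
    (hJb : Bornology.IsBounded J) (hJ0 : volume J ≠ 0) (t : ℝ) :
    ∫⁻ θ, ‖shiftedPoly c φ θ t‖ₑ ^ (2 * q) ∂(cond volume J)
      ≤ 256 * (q.factorial * (1 + ENNReal.ofReal (2 * Real.pi) / (volume J * linearSpacing φ q)))
        * (∑ n, ‖c n‖ₑ ^ 2) ^ q := by
  have hJt : volume J ≠ ∞ := hJb.measure_lt_top.ne
  obtain ⟨x₀, hx₀⟩ : J.Nonempty := nonempty_of_measure_ne_zero hJ0
  -- Lowering the separation to at most `1 / |J|` makes `J` a short interval.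
  have hd0 : min (linearSpacing φ q) (volume J)⁻¹ ≠ 0 := by
    rw [← pos_iff_ne_zero, lt_min_iff]
    exact ⟨pos_iff_ne_zero.2 (linearSpacing_ne_zero hφ q), ENNReal.inv_pos.2 hJt⟩
  have hdt : min (linearSpacing φ q) (volume J)⁻¹ ≠ ∞ :=
    ((min_le_right _ _).trans_lt (ENNReal.inv_ne_top.2 hJ0).lt_top).ne
  have hTδ : (volume J).toReal * (min (linearSpacing φ q) (volume J)⁻¹).toReal ≤ 1 := by
    rw [← ENNReal.toReal_mul, ← ENNReal.toReal_one]
    refine ENNReal.toReal_mono ENNReal.one_ne_top ?_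
    refine (mul_le_mul_right (min_le_right _ _) _).trans ?_
    rw [ENNReal.mul_inv_cancel hJ0 hJt]
  have hJI : J ⊆ Set.Icc (x₀ - (volume J).toReal) (x₀ + (volume J).toReal) :=
    subset_Icc_of_volume_le hJ hx₀ (ENNReal.ofReal_toReal hJt).ge ENNReal.toReal_nonneg
  have hint := (lintegral_mono_set hJI).trans
    (setLIntegral_enorm_shiftedPoly_pow_le c φ q t x₀ hd0 hdt hTδ (min_le_left _ _))
  rw [ProbabilityTheory.cond, lintegral_smul_measure, smul_eq_mul]
  refine (mul_le_mul_right hint _).trans ?_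
  rw [← mul_assoc]
  refine (mul_le_mul_left (inv_mul_div_min_le hJ0 hJt) _).trans (le_of_eq ?_)
  ring

/-! ### A Sobolev inequality on an interval -/

theorem ennreal_add_pow_le (a b : ℝ≥0∞) {p : ℕ} (hp : 1 ≤ p) :
    (a + b) ^ p ≤ 2 ^ p * (a ^ p + b ^ p) := by
  have h := ENNReal.rpow_add_le_mul_rpow_add_rpow a b (p := p) (by exact_mod_cast hp)
  simp only [ENNReal.rpow_natCast] at h
  refine h.trans ?_
  gcongr
  rw [← ENNReal.rpow_natCast]
  exact ENNReal.rpow_le_rpow_of_exponent_le (by norm_num) (by linarith)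

/-- Jensen's inequality for powers, for a measure of arbitrary total mass. -/
theorem lintegral_pow_le_measure_pow_mul {α : Type*} [MeasurableSpace α] (ν : Measure α)
    {g : α → ℝ≥0∞} (hg : AEMeasurable g ν) {p : ℕ} (hp : 1 ≤ p) :
    (∫⁻ x, g x ∂ν) ^ p ≤ ν Set.univ ^ (p - 1) * ∫⁻ x, g x ^ p ∂ν := by
  have h := eLpNorm_le_eLpNorm_mul_rpow_measure_univ (μ := ν) (p := 1) (q := (p : ℝ≥0∞)) (f := g)
    (by exact_mod_cast hp) hg.aestronglyMeasurable
  have hp0 : (p : ℝ) ≠ 0 := by positivity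
  rw [eLpNorm_one_eq_lintegral_enorm,
    eLpNorm_eq_lintegral_rpow_enorm_toReal (by positivity) (ENNReal.natCast_ne_top p)] at h
  simp only [enorm_eq_self, ENNReal.toReal_natCast, ENNReal.rpow_natCast, ENNReal.toReal_one] at h
  refine (pow_le_pow_left' h p).trans (le_of_eq ?_)
  rw [mul_pow, ← ENNReal.rpow_natCast, ← ENNReal.rpow_mul, one_div_mul_cancel hp0,
    ENNReal.rpow_one, mul_comm, ← ENNReal.rpow_natCast, ← ENNReal.rpow_mul, ← ENNReal.rpow_natCast,
    Nat.cast_sub hp]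
  congr 2
  field_simp
  simp

/-- A Sobolev inequality on an interval `L` at a scale `ℓ ≤ |L|`: the value at `t ∈ L` is compared with
the values on the part of `L` within distance `ℓ` of `t`, whose length is between `ℓ` and `2 * ℓ`.
The interval `L` may be unbounded. -/
theorem mul_enorm_pow_le_lintegral {f : ℝ → ℂ} (hf : ContDiff ℝ 1 f) {L : Set ℝ}
    (hL : L.OrdConnected) {t : ℝ} (ht : t ∈ L) {ℓ : ℝ≥0∞} (hℓ : ℓ ≠ ∞) (hℓL : ℓ ≤ volume L)
    {p : ℕ} (hp : 1 ≤ p) :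
    ℓ * ‖f t‖ₑ ^ p ≤ 4 ^ p * ((∫⁻ s in L, ‖f s‖ₑ ^ p) + ℓ ^ p * ∫⁻ s in L, ‖deriv f s‖ₑ ^ p) := by
  set I : Set ℝ := L ∩ Set.Icc (t - ℓ.toReal) (t + ℓ.toReal) with hI
  have hIo : I.OrdConnected := hL.inter Set.ordConnected_Icc
  have hIm : MeasurableSet I := hIo.measurableSet
  have htI : t ∈ I := ⟨ht, by constructor <;> simp⟩
  have hIL : I ⊆ L := Set.inter_subset_left
  have hI2 : volume I ≤ 2 * ℓ := by
    refine (measure_mono Set.inter_subset_right).trans (le_of_eq ?_)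
    rw [Real.volume_Icc, show t + ℓ.toReal - (t - ℓ.toReal) = 2 * ℓ.toReal by ring,
      ENNReal.ofReal_mul zero_le_two, ENNReal.ofReal_toReal hℓ, ENNReal.ofReal_ofNat]
  have hI1 : ℓ ≤ volume I := by
    -- If `L` leaves the window on one side of `t`, it contains the half-window on that side.
    by_cases h : L ⊆ Set.Icc (t - ℓ.toReal) (t + ℓ.toReal)
    · rwa [hI, Set.inter_eq_left.2 h]
    · obtain ⟨y, hyL, hy⟩ := Set.not_subset.1 h
      have h0 : (0 : ℝ) ≤ ℓ.toReal := ENNReal.toReal_nonneg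
      rw [Set.mem_Icc, not_and_or, not_le, not_le] at hy
      rcases hy with hy | hy
      · calc ℓ = volume (Set.Icc (t - ℓ.toReal) t) := by
              rw [Real.volume_Icc, sub_sub_cancel, ENNReal.ofReal_toReal hℓ]
          _ ≤ volume I := measure_mono fun z hz =>
              ⟨hL.out hyL ht ⟨hy.le.trans hz.1, hz.2⟩, hz.1, by linarith [hz.2]⟩
      · calc ℓ = volume (Set.Icc t (t + ℓ.toReal)) := by
              rw [Real.volume_Icc, add_sub_cancel_left, ENNReal.ofReal_toReal hℓ]
          _ ≤ volume I := measure_mono fun z hz =>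
              ⟨hL.out ht hyL ⟨hz.1, hz.2.trans hy.le⟩, by linarith [hz.1], hz.2⟩
  have hft : ∀ s ∈ I, ‖f t‖ₑ ≤ ‖f s‖ₑ + ∫⁻ x in I, ‖deriv f x‖ₑ := by
    intro s hs
    have key : ∀ x ∈ I, ∀ y ∈ I, x ≤ y → ‖f y - f x‖ₑ ≤ ∫⁻ x in I, ‖deriv f x‖ₑ :=
      fun x hx y hy hxy => (enorm_sub_le_lintegral_deriv_of_contDiffOn_Icc hf.contDiffOn hxy).trans
        (lintegral_mono_set (hIo.out hx hy))
    have h1 : ‖f t - f s‖ₑ ≤ ∫⁻ x in I, ‖deriv f x‖ₑ := by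
      rcases le_total s t with h | h
      · exact key s hs t htI h
      · rw [enorm_sub_rev]; exact key t htI s hs h
    calc ‖f t‖ₑ = ‖f s + (f t - f s)‖ₑ := by rw [add_sub_cancel]
      _ ≤ _ := (enorm_add_le _ _).trans (by gcongr)
  have hd : Measurable fun x => ‖deriv f x‖ₑ := (hf.continuous_deriv le_rfl).measurable.enorm
  have hD : (∫⁻ x in I, ‖deriv f x‖ₑ) ^ p
      ≤ (2 * ℓ) ^ (p - 1) * ∫⁻ s in L, ‖deriv f s‖ₑ ^ p := by
    refine (lintegral_pow_le_measure_pow_mul _ hd.aemeasurable hp).trans ?_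
    rw [Measure.restrict_apply_univ]
    gcongr
  calc ℓ * ‖f t‖ₑ ^ p ≤ volume I * ‖f t‖ₑ ^ p := by gcongr
    _ = ∫⁻ s in I, ‖f t‖ₑ ^ p := by rw [setLIntegral_const, mul_comm]
    _ ≤ ∫⁻ s in I, 2 ^ p * (‖f s‖ₑ ^ p + (∫⁻ x in I, ‖deriv f x‖ₑ) ^ p) := by
        refine setLIntegral_mono_ae' hIm (Filter.Eventually.of_forall fun s hs => ?_)
        exact (pow_le_pow_left' (hft s hs) p).trans (ennreal_add_pow_le _ _ hp)
    _ = 2 ^ p * ((∫⁻ s in I, ‖f s‖ₑ ^ p) + (∫⁻ x in I, ‖deriv f x‖ₑ) ^ p * volume I) := by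
        have hfm : Measurable fun x => ‖f x‖ₑ := hf.continuous.measurable.enorm
        rw [lintegral_const_mul _ (by fun_prop), lintegral_add_right _ measurable_const,
          setLIntegral_const]
    _ ≤ 2 ^ p * ((∫⁻ s in L, ‖f s‖ₑ ^ p)
          + ((2 * ℓ) ^ (p - 1) * ∫⁻ s in L, ‖deriv f s‖ₑ ^ p) * (2 * ℓ)) := by
        gcongr
    _ = 2 ^ p * ((∫⁻ s in L, ‖f s‖ₑ ^ p) + 2 ^ p * (ℓ ^ p * ∫⁻ s in L, ‖deriv f s‖ₑ ^ p)) := by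
        rw [mul_right_comm, ← pow_succ, Nat.sub_add_cancel hp, mul_pow, mul_assoc]
    _ ≤ 2 ^ p * (2 ^ p * (∫⁻ s in L, ‖f s‖ₑ ^ p)
          + 2 ^ p * (ℓ ^ p * ∫⁻ s in L, ‖deriv f s‖ₑ ^ p)) := by
        gcongr
        exact le_mul_of_one_le_left zero_le (one_le_pow₀ one_le_two)
    _ = _ := by
        rw [← mul_add, ← mul_assoc, ← mul_pow]; norm_num

/-! ### The supremum over an interval -/

theorem contDiff_shiftedPoly {N : ℕ} (c : Fin N → ℂ) (φ : Fin N → ℝ) (θ : ℝ) :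
    ContDiff ℝ 1 fun s => shiftedPoly c φ θ s := by
  unfold shiftedPoly
  refine ContDiff.sum fun n _ => contDiff_const.mul (contDiff_const.mul ?_).cexp
  exact Complex.ofRealCLM.contDiff.comp ((contDiff_const.add contDiff_id).mul contDiff_const)

theorem deriv_shiftedPoly {N : ℕ} (c : Fin N → ℂ) (φ : Fin N → ℝ) (θ s : ℝ) :
    deriv (fun s => shiftedPoly c φ θ s) s
      = shiftedPoly (fun n => c n * (Complex.I * φ n)) φ θ s := by
  unfold shiftedPoly
  refine HasDerivAt.deriv (HasDerivAt.fun_sum fun n _ => ?_)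
  have h1 : HasDerivAt (fun s : ℝ => (((θ + s) * φ n : ℝ) : ℂ)) ((1 * φ n : ℝ) : ℂ) s :=
    (((hasDerivAt_id s).const_add θ).mul_const (φ n)).ofReal_comp
  refine (((h1.const_mul Complex.I).cexp).const_mul (c n)).congr_deriv ?_
  push_cast; ring

theorem lintegral_lintegral_shiftedPoly_pow_le {N : ℕ} (c : Fin N → ℂ) (φ : Fin N → ℝ) (p : ℕ)
    (m : Measure ℝ) [SFinite m] (L : Set ℝ) {B : ℝ≥0∞}
    (hB : ∀ t, ∫⁻ θ, ‖shiftedPoly c φ θ t‖ₑ ^ p ∂m ≤ B) :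
    ∫⁻ θ, (∫⁻ t in L, ‖shiftedPoly c φ θ t‖ₑ ^ p) ∂m ≤ volume L * B := by
  rw [lintegral_lintegral_swap]
  · refine (lintegral_mono fun t => hB t).trans ?_
    rw [setLIntegral_const, mul_comm]
  · exact ((continuous_shiftedPoly c φ).measurable.enorm.pow_const p).aemeasurable

theorem maxFreq_ne_top {N : ℕ} (φ : Fin N → ℝ) : maxFreq φ ≠ ∞ := by
  refine ((iSup_le fun n => ?_ : maxFreq φ ≤ ∑ n, ENNReal.ofReal |φ n|).trans_lt
    (ENNReal.sum_lt_top.2 fun n _ => ENNReal.ofReal_lt_top)).ne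
  exact Finset.single_le_sum (f := fun n => ENNReal.ofReal |φ n|) (fun _ _ => zero_le)
    (Finset.mem_univ n)

theorem maxFreq_ne_zero {N : ℕ} [NeZero N] {φ : Fin N → ℝ} (hφ : LinearIndependent ℚ φ) :
    maxFreq φ ≠ 0 := by
  refine ((ENNReal.ofReal_pos.2 (abs_pos.2 (hφ.ne_zero 0))).trans_le ?_).ne'
  exact le_iSup (fun n => ENNReal.ofReal |φ n|) 0

/-- With `ℓ = min(V, 1/Φ)` one has `V / ℓ = max(1, V Φ)`; only this inequality is needed, and it also
holds for `V = ∞`. -/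
theorem le_min_mul_max {V Φ : ℝ≥0∞} (h0 : Φ ≠ 0) (ht : Φ ≠ ∞) :
    V ≤ min V (1 / Φ) * max 1 (V * Φ) := by
  rcases min_choice V (1 / Φ) with h | h
  · rw [h]; exact le_mul_of_one_le_right zero_le (le_max_left _ _)
  · rw [h]
    calc V = 1 / Φ * (V * Φ) := by
          rw [one_div, mul_left_comm, ENNReal.inv_mul_cancel h0 ht, mul_one]
      _ ≤ _ := by gcongr; exact le_max_right _ _

/-- The local maximal inequality in terms of `2 * q`-th powers, before the root is taken. -/
theorem lintegral_iSup_shiftedPoly_pow_le {N : ℕ} [NeZero N] (c : Fin N → ℂ) {φ : Fin N → ℝ}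
    (hφ : LinearIndependent ℚ φ) {q : ℕ} (hq : 1 ≤ q) {J : Set ℝ} (hJ : J.OrdConnected)
    (hJb : Bornology.IsBounded J) (hJ0 : volume J ≠ 0) {L : Set ℝ} (hL : L.OrdConnected) :
    ∫⁻ θ, (⨆ t ∈ L, ‖shiftedPoly c φ θ t‖ₑ) ^ (2 * q) ∂(cond volume J)
      ≤ 2048 ^ (2 * q)
        * (q.factorial * (1 + ENNReal.ofReal (2 * Real.pi) / (volume J * linearSpacing φ q)))
        * max 1 (volume L * maxFreq φ)
        * ((∑ n, ‖c n‖ₑ ^ 2) ^ (1 / 2 : ℝ)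
          + min (volume L) (1 / maxFreq φ)
            * (∑ n, ‖c n‖ₑ ^ 2 * ‖φ n‖ₑ ^ 2) ^ (1 / 2 : ℝ)) ^ (2 * q) := by
  have hp : 1 ≤ 2 * q := by omega
  have hmv := fun c : Fin N → ℂ => lintegral_enorm_shiftedPoly_pow_le c hφ q hJ hJb hJ0
  have hΦ0 := maxFreq_ne_zero hφ
  have hΦt := maxFreq_ne_top φ
  have : IsProbabilityMeasure (cond volume J) :=
    cond_isProbabilityMeasure_of_finite hJ0 hJb.measure_lt_top.ne
  have hsq : ∀ x : ℝ≥0∞, x ^ q = (x ^ (1 / 2 : ℝ)) ^ (2 * q) := fun x => by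
    rw [pow_mul, ← ENNReal.rpow_natCast (x ^ (1 / 2 : ℝ)), ← ENNReal.rpow_mul]; norm_num
  have hderiv : ∑ n, ‖c n * (Complex.I * φ n)‖ₑ ^ 2 = ∑ n, ‖c n‖ₑ ^ 2 * ‖φ n‖ₑ ^ 2 := by
    refine Finset.sum_congr rfl fun n _ => ?_
    rw [enorm_mul, enorm_mul, mul_pow]
    simp [enorm_eq_nnnorm]
  have hA := fun t => (hmv c t).trans_eq (by rw [hsq])
  have hD := fun t => (hmv (fun n => c n * (Complex.I * φ n)) t).trans_eq (by rw [hderiv, hsq])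
  generalize (q.factorial * (1 + ENNReal.ofReal (2 * Real.pi)
    / (volume J * linearSpacing φ q)) : ℝ≥0∞) = X at *
  generalize (∑ n, ‖c n‖ₑ ^ 2) ^ (1 / 2 : ℝ) = A at *
  generalize (∑ n, ‖c n‖ₑ ^ 2 * ‖φ n‖ₑ ^ 2) ^ (1 / 2 : ℝ) = D at *
  -- For `|L| = 0` the scale `ℓ` vanishes and the Sobolev inequality is empty.
  rcases eq_or_ne (volume L) 0 with hL0 | hL0
  · have hsub : L.Subsingleton := by
      intro a ha b hb
      have h := measure_mono_null (hL.uIcc_subset ha hb) hL0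
      rw [Real.volume_interval, ENNReal.ofReal_eq_zero] at h
      linarith [abs_nonpos_iff.1 h]
    rcases hsub.eq_empty_or_singleton with rfl | ⟨t, rfl⟩
    · simp [show q ≠ 0 by omega]
    · simp only [Set.mem_singleton_iff, iSup_iSup_eq_left]
      refine (hA t).trans ?_
      have h2 : (256 : ℝ≥0∞) ≤ 2048 ^ (2 * q) :=
        le_trans (by norm_num) (le_self_pow₀ (by norm_num : (1 : ℝ≥0∞) ≤ 2048) (by omega))
      calc 256 * X * A ^ (2 * q) ≤ 2048 ^ (2 * q) * X * 1 * A ^ (2 * q) := by rw [mul_one]; gcongr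
        _ ≤ _ := by
          gcongr
          · exact le_max_left _ _
          · exact le_self_add
  · set ℓ := min (volume L) (1 / maxFreq φ) with hℓ
    have hℓ0 : ℓ ≠ 0 := by
      rw [← pos_iff_ne_zero, hℓ, lt_min_iff]
      exact ⟨pos_iff_ne_zero.2 hL0, by rw [one_div]; exact ENNReal.inv_pos.2 hΦt⟩
    have hℓt : ℓ ≠ ∞ :=
      ((min_le_right _ _).trans_lt (by rw [one_div]; exact (ENNReal.inv_ne_top.2 hΦ0).lt_top)).ne
    have hpt : ∀ θ, ℓ * (⨆ t ∈ L, ‖shiftedPoly c φ θ t‖ₑ) ^ (2 * q)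
        ≤ 4 ^ (2 * q) * ((∫⁻ s in L, ‖shiftedPoly c φ θ s‖ₑ ^ (2 * q)) + ℓ ^ (2 * q)
          * ∫⁻ s in L, ‖shiftedPoly (fun n => c n * (Complex.I * φ n)) φ θ s‖ₑ ^ (2 * q)) := by
      intro θ
      rw [ENNReal.iSup₂_pow_of_ne_zero _ (by omega : 2 * q ≠ 0)]
      simp_rw [ENNReal.mul_iSup]
      refine iSup₂_le fun t ht => ?_
      have := mul_enorm_pow_le_lintegral (contDiff_shiftedPoly c φ θ) hL ht hℓt (min_le_left _ _) hp
      simpa only [deriv_shiftedPoly] using this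
    have hmeas : ∀ c : Fin N → ℂ,
        Measurable fun θ => ∫⁻ s in L, ‖shiftedPoly c φ θ s‖ₑ ^ (2 * q) := fun c =>
      ((continuous_shiftedPoly c φ).measurable.enorm.pow_const (2 * q)).lintegral_prod_right'
    refine (ENNReal.mul_le_mul_iff_right hℓ0 hℓt).1 ?_
    calc ℓ * ∫⁻ θ, (⨆ t ∈ L, ‖shiftedPoly c φ θ t‖ₑ) ^ (2 * q) ∂(cond volume J)
        = ∫⁻ θ, ℓ * (⨆ t ∈ L, ‖shiftedPoly c φ θ t‖ₑ) ^ (2 * q) ∂(cond volume J) :=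
          (lintegral_const_mul' _ _ hℓt).symm
      _ ≤ _ := lintegral_mono hpt
      _ = 4 ^ (2 * q) * (∫⁻ θ, (∫⁻ s in L, ‖shiftedPoly c φ θ s‖ₑ ^ (2 * q)) ∂(cond volume J)
            + ℓ ^ (2 * q) * ∫⁻ θ, (∫⁻ s in L, ‖shiftedPoly (fun n => c n * (Complex.I * φ n))
              φ θ s‖ₑ ^ (2 * q)) ∂(cond volume J)) := by
          rw [lintegral_const_mul' _ _ (ENNReal.pow_ne_top ENNReal.ofNat_ne_top),
            lintegral_add_left (hmeas _), lintegral_const_mul _ (hmeas _)]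
      _ ≤ 4 ^ (2 * q) * (volume L * (256 * X * A ^ (2 * q))
            + ℓ ^ (2 * q) * (volume L * (256 * X * D ^ (2 * q)))) := by
          gcongr
          · exact lintegral_lintegral_shiftedPoly_pow_le _ _ _ _ _ hA
          · exact lintegral_lintegral_shiftedPoly_pow_le _ _ _ _ _ hD
      _ = 4 ^ (2 * q) * volume L * (256 * X) * (A ^ (2 * q) + (ℓ * D) ^ (2 * q)) := by
          rw [mul_pow]; ring
      _ ≤ 4 ^ (2 * q) * (ℓ * max 1 (volume L * maxFreq φ)) * (256 * X)
            * ((A + ℓ * D) ^ (2 * q) + (A + ℓ * D) ^ (2 * q)) := by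
          gcongr
          · exact le_min_mul_max hΦ0 hΦt
          · exact le_self_add
          · exact le_add_self
      _ = ℓ * (512 * 4 ^ (2 * q) * X * max 1 (volume L * maxFreq φ) * (A + ℓ * D) ^ (2 * q)) := by
          ring
      _ ≤ _ := by
          gcongr
          calc (512 : ℝ≥0∞) * 4 ^ (2 * q) ≤ 512 ^ (2 * q) * 4 ^ (2 * q) := by
                gcongr
                exact le_self_pow₀ (by norm_num) (by omega)
            _ = _ := by rw [← mul_pow]; norm_num
end LocalMeanValue

theorem theorem2 (q : ℕ) (hq : 1 ≤ q) :
    ∃ C : ℝ≥0, ∀ (N : ℕ) (φ : Fin N → ℝ), LinearIndependent ℚ φ →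
      ∀ (c : Fin N → ℂ) (J : Set ℝ), J.OrdConnected → Bornology.IsBounded J → volume J ≠ 0 →
      ∀ L : Set ℝ, L.OrdConnected →
        eLpNorm (fun θ : ℝ => ⨆ t ∈ L, ‖LocalMeanValue.shiftedPoly c φ θ t‖ₑ)
            (2 * (q : ℝ≥0∞)) (ProbabilityTheory.cond volume J)
          ≤ (C : ℝ≥0∞) * LocalMeanValue.factorB φ J q
            * (max 1 (volume L * LocalMeanValue.maxFreq φ)) ^ (1 / (2 * (q : ℝ)))
            * ((∑ n, ‖c n‖ₑ ^ 2) ^ (1 / 2 : ℝ)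
              + min (volume L) (1 / LocalMeanValue.maxFreq φ)
                * (∑ n, ‖c n‖ₑ ^ 2 * ‖φ n‖ₑ ^ 2) ^ (1 / 2 : ℝ)) := by
  refine ⟨2048, fun N φ hφ c J hJ hJb hJ0 L hL => ?_⟩
  -- Without frequencies `maxFreq φ = 0`, but then the polynomial vanishes.
  rcases Nat.eq_zero_or_pos N with rfl | hN
  · simp [LocalMeanValue.shiftedPoly]
  have : NeZero N := ⟨hN.ne'⟩
  have h := LocalMeanValue.lintegral_iSup_shiftedPoly_pow_le c hφ hq hJ hJb hJ0 hL
  have hq0 : (0 : ℝ) < 2 * q := by positivity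
  have hroot : ∀ x : ℝ≥0∞, (x ^ (2 * q)) ^ (1 / (2 * (q : ℝ))) = x := fun x => by
    rw [← ENNReal.rpow_natCast, ← ENNReal.rpow_mul]
    push_cast
    rw [mul_one_div_cancel hq0.ne', ENNReal.rpow_one]
  rw [eLpNorm_eq_lintegral_rpow_enorm_toReal (by positivity)
    (ENNReal.mul_ne_top ENNReal.ofNat_ne_top (ENNReal.natCast_ne_top q))]
  have hexp : (2 * (q : ℝ≥0∞)).toReal = ((2 * q : ℕ) : ℝ) := by simp
  simp only [hexp, ENNReal.rpow_natCast, enorm_eq_self]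
  push_cast
  refine (ENNReal.rpow_le_rpow h (by positivity)).trans (le_of_eq ?_)
  rw [ENNReal.mul_rpow_of_nonneg _ _ (by positivity), ENNReal.mul_rpow_of_nonneg _ _ (by positivity),
    ENNReal.mul_rpow_of_nonneg _ _ (by positivity), hroot, hroot, LocalMeanValue.factorB]
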